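/- All tournaments are finite. For a tournament $G$ and $A\subseteq V(G)$, let $G[A]$ be the subtournament induced on $A$. The chromatic number $\chi(G)$ is the minimum $k$ such that $V(G)$ can be partitioned into $k$ (possibly empty) sets each inducing an acyclic subtournament, and $\chi(A)=\chi(G[A])$. A cyclic triangle is a tournament with three vertices, each of out-degree one; we use the same name for its vertex set. For disjoint $A,B\subseteq V(G)$, write $A\Rightarrow B$ if no edge has its tail in $B$ and its head in $A$. For tournaments $G,H$, we say $G$ is $H$-free if no subtournament of $G$ is isomorphic to $H$, and $\chi_H(G)$ is the minimum $k$ such that $V(G)$ can be partitioned into $k$ sets each inducing an $H$-free tournament. A law for $G$ is a set $\mathcal{L}$ of subsets of $V(G)$, each including the vertex set of a cyclic triangle of $G$; its order is the maximum cardinality of its members (or $|V(G)|$ if $\mathcal{L}=\emptyset$), and $\chi_{\mathcal{L}}(G)$ is the minimum $k$ such that $V(G)$ can be partitioned into $k$ sets none of which includes a member of $\mathcal{L}$. **Theorem 3.6.** 1. For every tournament $H$ with $\chi(H)\ge 2$ and every integer $c\ge 0$, there exists $d\ge 0$ such that for every tournament $G$ with $\chi_H(G)\ge d$ there are pairwise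 disjoint sets $P,A,Q\subseteq V(G)$ such that $P\Rightarrow A\Rightarrow Q$, $G[A]$ is isomorphic to $H$, and $\chi(P),\chi(Q)\ge c$. 2. For all integers $c,\ell\ge 0$ there exists $n$ such that for every tournament $G$ and every law $\mathcal{L}$ for $G$ of order at most $\ell$ with $\chi_{\mathcal{L}}(G)>n$, there are pairwise disjoint sets $P,A,Q\subseteq V(G)$ such that $P\Rightarrow A\Rightarrow Q$, $A\in\mathcal{L}$, and $\chi(P),\chi(Q)\ge c$. 3. For every integer $c\ge 0$ there exists $d\ge 0$ such that for every tournament $G$ with $\chi(G)\ge d$ there are pairwise disjoint sets $P,A,Q\subseteq V(G)$ such that $P\Rightarrow A\Rightarrow Q$, $A$ is a cyclic triangle, and $\chi(P),\chi(Q)\ge c$. 4. For every integer $c\ge 0$ there exists $d\ge 0$ such that for every tournament $G$ with $\chi(G)\ge d$ there are disjoint sets $A,B\subseteq V(G)$ such that $A\Rightarrow B$, $A$ is a cyclic triangle, and $\chi(B)\ge c$. -/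

import Mathlib

universe u v

/-- A tournament with vertex set `V`: a loopless digraph in which every two distinct vertices
are joined by exactly one edge. `G.Adj a b` says that there is an edge with tail `a` and
head `b`. Finiteness of the vertex set is imposed where tournaments are quantified over. -/
structure Tournament (V : Type*) extends Digraph V where
  loopless : ∀ a, ¬ Adj a a
  adj_iff_not_adj : ∀ a b, a ≠ b → (Adj a b ↔ ¬ Adj b a)

namespace Tournament

variable {V W : Type*}

/-- The subtournament `G[A]`. -/
def induce (G : Tournament V) (A : Set V) : Tournament A where
  Adj a b := G.Adj a b
  loopless a := G.loopless a
  adj_iff_not_adj a b h := G.adj_iff_not_adj a b (fun e => h (Subtype.ext e))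

/-- Two tournaments are isomorphic if there is a bijection of their vertex sets that preserves
and reflects adjacency. -/
def IsIsomorphic (G : Tournament V) (H : Tournament W) : Prop :=
  Nonempty (RelIso G.Adj H.Adj)

/-- No directed cycle: no vertex can be reached from itself along a directed walk of
positive length. -/
def IsAcyclic (G : Tournament V) : Prop :=
  ∀ a, ¬ Relation.TransGen G.Adj a a

/-- `G` is `H`-free if no subtournament of `G` is isomorphic to `H`. -/
def IsFree (G : Tournament V) (H : Tournament W) : Prop :=
  ∀ A : Set V, ¬ (G.induce A).IsIsomorphic H

/-- A cyclic triangle: a tournament with three vertices, each with out-degree one. -/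
def IsCyclicTriangle (G : Tournament V) : Prop :=
  Nat.card V = 3 ∧ ∀ a, {b | G.Adj a b}.ncard = 1

/-- `G.CompletePair A B` is `A ⇒ B`: the sets are disjoint, and no edge has tail in `B` and head
in `A`. -/
def CompletePair (G : Tournament V) (A B : Set V) : Prop :=
  Disjoint A B ∧ ∀ a ∈ A, ∀ b ∈ B, ¬ G.Adj b a

end Tournament

/-- The minimum `k` such that `V` can be partitioned into `k` (possibly empty) sets each with the
property `p`, and `⊤` if there is no such `k`. The partition is given by the function that maps a
vertex to the index of its part. -/
noncomputable def partitionNumber {V : Type*} (p : Set V → Prop) : ℕ∞ :=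
  ⨅ k ∈ {k : ℕ | ∃ f : V → Fin k, ∀ i, p (f ⁻¹' {i})}, (k : ℕ∞)

namespace Tournament

variable {V W : Type*}

/-- The chromatic number `χ(G)`. -/
noncomputable def chromaticNumber (G : Tournament V) : ℕ∞ :=
  partitionNumber fun A : Set V => (G.induce A).IsAcyclic

/-- `χ(A) = χ(G[A])` for a set `A` of vertices of `G`. -/
noncomputable def chromaticNumberOn (G : Tournament V) (A : Set V) : ℕ∞ :=
  (G.induce A).chromaticNumber

/-- `χ_H(G)`: the minimum number of parts, each inducing an `H`-free tournament. -/
noncomputable def freeChromaticNumber (H : Tournament W) (G : Tournament V) : ℕ∞ :=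
  partitionNumber fun A : Set V => (G.induce A).IsFree H

/-- `L` is a law for `G`: each member of `L` is a set of vertices of `G` that includes the vertex
set of a cyclic triangle of `G`. -/
def IsLaw (G : Tournament V) (L : Set (Set V)) : Prop :=
  ∀ X ∈ L, ∃ T ⊆ X, (G.induce T).IsCyclicTriangle

end Tournament

open Classical in
/-- The order of a law `L` in a tournament with (finite) vertex set `V`: the maximum cardinality of
its members, and `|V|` if `L` is empty. -/
noncomputable def lawOrder {V : Type*} (L : Set (Set V)) : ℕ :=
  if L = ∅ then Nat.card V else sSup (Set.ncard '' L)

/-- The `L`-chromatic number `χ_L`: the minimum number of parts, none of which includes a member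
of `L`. -/
noncomputable def lawChromaticNumber {V : Type*} (L : Set (Set V)) : ℕ∞ :=
  partitionNumber fun A : Set V => ∀ X ∈ L, ¬ X ⊆ A

/-! A tournament without cyclic triangles is transitive, so colouring means avoiding monochromatic
cyclic triangles. If no member of a law has both its common in-neighbours and its common
out-neighbours of large chromatic number, each member fails on one side. The law is then a union of
two thin laws, the second thin once all edges are reversed. A bound for thin laws
(`exists_splitsInto_of_isThinLaw`) and the product of two partitions give the theorem for laws;
copies of `H` and cyclic triangles are special laws.

Call a set small if boundedly many parts free of the law cover it. For a thin law there is a bounded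
set `X` such that all vertices outside a small set have out-neighbourhoods in `X` of chromatic
number above `C` (`exists_finset_out_chromatic`). Classify these vertices by that out-neighbourhood:
a member of the law inside one class would have the whole out-neighbourhood among its common
out-neighbours, against thinness.

The set `X` grows by induction from three layers, arranged so that a colour present in each layer
yields a monochromatic cyclic triangle. The layers exist because vertices with small in- or
out-neighbourhoods form a small set; for out-neighbourhoods this uses the domination theorem
`exists_dominates_or_not_splitsInto`. -/

/-- `SplitsInto p Y k`: the set `Y` can be partitioned into `k` (possibly empty) sets, each with
the property `p`. -/
def SplitsInto {V : Type*} (p : Set V → Prop) (Y : Set V) (k : ℕ) : Prop :=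
  ∃ f : V → ℕ, (∀ v ∈ Y, f v < k) ∧ ∀ i, p {v | v ∈ Y ∧ f v = i}

/-! ### Partitions into parts with a hereditary property -/

namespace SplitsInto

variable {V : Type*} {p q : Set V → Prop} {Y Z : Set V} {k l : ℕ}

theorem mono_left (hp : Antitone p) (h : SplitsInto p Y k) (hZ : Z ⊆ Y) : SplitsInto p Z k := by
  obtain ⟨f, hf, hi⟩ := h
  refine ⟨f, fun v hv => hf v (hZ hv), fun i => hp ?_ (hi i)⟩
  exact fun v hv => ⟨hZ hv.1, hv.2⟩

theorem mono_right (h : SplitsInto p Y k) (hl : k ≤ l) : SplitsInto p Y l := by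
  obtain ⟨f, hf, hi⟩ := h
  exact ⟨f, fun v hv => (hf v hv).trans_le hl, hi⟩

theorem imp (h : SplitsInto p Y k) (hpq : ∀ S, p S → q S) : SplitsInto q Y k := by
  obtain ⟨f, hf, hi⟩ := h
  exact ⟨f, hf, fun i => hpq _ (hi i)⟩

theorem one (hp : Antitone p) (h : p Y) : SplitsInto p Y 1 :=
  ⟨fun _ => 0, fun _ _ => one_pos, fun _ => hp (Set.sep_subset _ _) h⟩

theorem union (hp : Antitone p) (hY : SplitsInto p Y k) (hZ : SplitsInto p Z l) :
    SplitsInto p (Y ∪ Z) (k + l) := by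
  classical
  obtain ⟨f, hf, hi⟩ := hY
  obtain ⟨g, hg, hj⟩ := hZ
  refine ⟨fun v => if v ∈ Y then f v else k + g v, ?_, fun i => ?_⟩
  · intro v hv
    by_cases h : v ∈ Y
    · have := hf v h
      simp only [h, if_true]
      omega
    · have := hg v (hv.resolve_left h)
      simp only [h, if_false]
      omega
  · by_cases hik : i < k
    · refine hp ?_ (hi i)
      rintro v ⟨hv, e⟩
      by_cases h : v ∈ Y
      · simp only [h, if_true] at e
        exact ⟨h, e⟩
      · simp only [h, if_false] at e
        omega
    · refine hp ?_ (hj (i - k))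
      rintro v ⟨hv, e⟩
      by_cases h : v ∈ Y
      · simp only [h, if_true] at e
        have := hf v h
        omega
      · simp only [h, if_false] at e
        exact ⟨hv.resolve_left h, by omega⟩

theorem biUnion {ι : Type*} (hp : Antitone p) (h0 : p ∅) (X : Finset ι) (Y : ι → Set V)
    (h : ∀ i ∈ X, SplitsInto p (Y i) k) : SplitsInto p (⋃ i ∈ X, Y i) (X.card * k) := by
  classical
  induction X using Finset.induction_on with
  | empty => exact ⟨fun _ => 0, by simp, by simpa using h0⟩
  | insert a X ha ih =>
    rw [Finset.set_biUnion_insert, Finset.card_insert_of_notMem ha, add_mul, one_mul, add_comm]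
    exact (h a (Finset.mem_insert_self a X)).union hp
      (ih fun i hi => h i (Finset.mem_insert_of_mem hi))

theorem finset (hp : Antitone p) (h0 : p ∅) (h1 : ∀ v, p {v}) (X : Finset V) :
    SplitsInto p (X : Set V) X.card := by
  have := biUnion (k := 1) hp h0 X (fun v => {v}) fun v _ => one hp (h1 v)
  rw [mul_one] at this
  refine this.mono_left hp fun v hv => ?_
  simpa using hv

theorem inter {p q : Set V → Prop} (hp : Antitone p) (hq : Antitone q)
    (h : SplitsInto p Y k) (h' : SplitsInto q Y l) :
    SplitsInto (fun S => p S ∧ q S) Y (k * l) := by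
  obtain ⟨f, hf, hi⟩ := h
  obtain ⟨g, hg, hj⟩ := h'
  -- A pair of colours is encoded in base `k`; remainder and quotient recover it.
  refine ⟨fun v => f v + k * g v, fun v hv => ?_, fun i => ?_⟩
  · have h1 := hf v hv
    have h2 : k * (g v + 1) ≤ k * l := Nat.mul_le_mul_left k (hg v hv)
    rw [mul_add, mul_one] at h2
    show f v + k * g v < k * l
    omega
  · have key : ∀ v, v ∈ Y → f v + k * g v = i → f v = i % k ∧ g v = i / k := by
      intro v hv e
      have h1 := hf v hv
      subst e
      refine ⟨?_, ?_⟩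
      · rw [Nat.add_mul_mod_self_left, Nat.mod_eq_of_lt h1]
      · rw [Nat.add_mul_div_left _ _ (by omega), Nat.div_eq_of_lt h1, zero_add]
    refine ⟨hp ?_ (hi (i % k)), hq ?_ (hj (i / k))⟩
    · exact fun v hv => ⟨hv.1, (key v hv.1 hv.2).1⟩
    · exact fun v hv => ⟨hv.1, (key v hv.1 hv.2).2⟩

/-- If `Y` cannot be partitioned into `k` sets with the property `p`, then every partition of a
superset into `k + 1` such sets uses every one of its parts on `Y`. -/
theorem exists_color (hp : Antitone p) (h : ¬ SplitsInto p Y k) (hYZ : Y ⊆ Z) {f : V → ℕ}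
    (hf : ∀ v ∈ Z, f v < k + 1) (hi : ∀ i, p {v | v ∈ Z ∧ f v = i}) {i : ℕ} (hik : i < k + 1) :
    ∃ v ∈ Y, f v = i := by
  by_contra! hne
  -- If colour `i` is missing on `Y`, renaming colour `k` to `i` leaves only `k` colours.
  refine h ⟨fun v => if f v = k then i else f v, fun v hv => ?_, fun j => ?_⟩
  · have h1 := hf v (hYZ hv)
    have h2 := hne v hv
    show (if f v = k then i else f v) < k
    split_ifs <;> omega
  · by_cases hj : j = i
    · refine hp ?_ (hi k)
      rintro v ⟨hv, e⟩
      refine ⟨hYZ hv, ?_⟩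
      have h2 := hne v hv
      by_contra h3
      simp only [h3, if_false] at e
      exact h2 (e.trans hj)
    · refine hp ?_ (hi j)
      rintro v ⟨hv, e⟩
      refine ⟨hYZ hv, ?_⟩
      by_cases h3 : f v = k
      · simp only [h3, if_true] at e
        exact absurd e.symm hj
      · simpa only [h3, if_false] using e

end SplitsInto

theorem partitionNumber_le {V : Type*} {p : Set V → Prop} {k : ℕ}
    (h : SplitsInto p Set.univ k) : partitionNumber p ≤ k := by
  obtain ⟨f, hf, hi⟩ := h
  refine iInf₂_le k ⟨fun v => ⟨f v, hf v trivial⟩, fun i => ?_⟩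
  convert hi i using 1
  ext v
  simp [Fin.ext_iff]

theorem exists_of_partitionNumber_lt {V : Type*} {p : Set V → Prop} {k : ℕ}
    (h : partitionNumber p < k) : ∃ j < k, ∃ f : V → Fin j, ∀ i, p (f ⁻¹' {i}) := by
  simp only [partitionNumber, iInf_lt_iff] at h
  obtain ⟨j, hj, hjk⟩ := h
  exact ⟨j, by exact_mod_cast hjk, hj⟩

theorem partitionNumber_mono {V : Type*} {p q : Set V → Prop} (h : ∀ S, p S → q S) :
    partitionNumber q ≤ partitionNumber p :=
  le_iInf₂ fun k ⟨f, hf⟩ => iInf₂_le k ⟨f, fun i => h _ (hf i)⟩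

theorem partitionNumber_le_one {V : Type*} {p : Set V → Prop} (h : p Set.univ) :
    partitionNumber p ≤ 1 :=
  iInf₂_le_of_le 1 ⟨fun _ => 0, fun i => by
    convert h
    ext v
    simp [Subsingleton.elim i 0]⟩ (by simp)

/-! ### Cyclic triangles and acyclicity -/

namespace Tournament

section

variable {V : Type*} (G : Tournament V)

/-- No three vertices of `S` form a cyclic triangle. -/
def TriangleFree (S : Set V) : Prop :=
  ∀ a ∈ S, ∀ b ∈ S, ∀ c ∈ S, G.Adj a b → G.Adj b c → ¬ G.Adj c a

/-- The common out-neighbours of the vertices in `A`. -/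
def commonOut (A : Set V) : Set V := {v | ∀ a ∈ A, G.Adj a v}

/-- The common in-neighbours of the vertices in `A`. -/
def commonIn (A : Set V) : Set V := {v | ∀ a ∈ A, G.Adj v a}

/-- The tournament obtained by reversing every edge. -/
def reverse : Tournament V where
  Adj a b := G.Adj b a
  loopless := G.loopless
  adj_iff_not_adj a b h := G.adj_iff_not_adj b a h.symm

variable {G}

theorem Adj.ne {a b : V} (h : G.Adj a b) : a ≠ b := by
  rintro rfl
  exact G.loopless _ h

theorem Adj.not_adj {a b : V} (h : G.Adj a b) : ¬ G.Adj b a :=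
  (G.adj_iff_not_adj a b (Adj.ne h)).1 h

theorem adj_of_not_adj {a b : V} (hab : a ≠ b) (h : ¬ G.Adj b a) : G.Adj a b :=
  (G.adj_iff_not_adj a b hab).2 h

theorem triangleFree_antitone : Antitone G.TriangleFree :=
  fun _ _ h hT a ha b hb c hc => hT a (h ha) b (h hb) c (h hc)

theorem triangleFree_of_isAcyclic {S : Set V} (h : (G.induce S).IsAcyclic) :
    G.TriangleFree S := by
  intro a ha b hb c hc hab hbc hca
  have h1 : (G.induce S).Adj ⟨a, ha⟩ ⟨b, hb⟩ := hab
  have h2 : (G.induce S).Adj ⟨b, hb⟩ ⟨c, hc⟩ := hbc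
  have h3 : (G.induce S).Adj ⟨c, hc⟩ ⟨a, ha⟩ := hca
  exact h _ (((Relation.TransGen.single h1).tail h2).tail h3)

/-- Without cyclic triangles adjacency is transitive, so a closed walk collapses to a loop. -/
theorem isAcyclic_of_forall (h : ∀ a b c, G.Adj a b → G.Adj b c → ¬ G.Adj c a) : G.IsAcyclic := by
  have htrans : ∀ a b c, G.Adj a b → G.Adj b c → G.Adj a c := by
    intro a b c hab hbc
    refine adj_of_not_adj ?_ (h a b c hab hbc)
    rintro rfl
    exact Adj.not_adj hab hbc
  have key : ∀ a b, Relation.TransGen G.Adj a b → G.Adj a b := by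
    intro a b hab
    induction hab with
    | single h => exact h
    | tail _ h2 ih => exact htrans _ _ _ ih h2
  exact fun a ha => G.loopless a (key a a ha)

theorem not_triangleFree_of_isCyclicTriangle {T : Set V} (h : (G.induce T).IsCyclicTriangle) :
    ¬ G.TriangleFree T := by
  obtain ⟨h3, hout⟩ := h
  intro hT
  have hne : Nonempty T := by
    by_contra h0
    rw [not_nonempty_iff] at h0
    simp at h3
  obtain ⟨a⟩ := hne
  have hex : ∀ v : T, ∃ w : T, ∀ x : T, G.Adj v x ↔ x = w := by
    intro v
    obtain ⟨w, hw⟩ := Set.ncard_eq_one.1 (hout v)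
    exact ⟨w, fun x => Set.ext_iff.1 hw x⟩
  obtain ⟨b, hb⟩ := hex a
  obtain ⟨c, hc⟩ := hex b
  have hab : G.Adj a b := (hb b).2 rfl
  have hbc : G.Adj b c := (hc c).2 rfl
  refine hT a a.2 b b.2 c c.2 hab hbc (adj_of_not_adj ?_ ?_)
  · intro e
    rw [e] at hbc
    exact Adj.not_adj hab hbc
  · intro hac
    have := (hb c).1 hac
    rw [this] at hbc
    exact G.loopless _ hbc

theorem isCyclicTriangle_of_adj {a b c : V} (hab : G.Adj a b) (hbc : G.Adj b c)
    (hca : G.Adj c a) : (G.induce {a, b, c}).IsCyclicTriangle := by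
  have h1 := Adj.ne hab
  have h2 := Adj.ne hbc
  have h3 := Adj.ne hca
  refine ⟨?_, ?_⟩
  · rw [Nat.card_coe_set_eq, Set.ncard_eq_three]
    exact ⟨a, b, c, h1, h3.symm, h2, rfl⟩
  · have key : ∀ v w : ({a, b, c} : Set V), (∀ x ∈ ({a, b, c} : Set V), G.Adj v x ↔ x = w) →
        {x | (G.induce {a, b, c}).Adj v x}.ncard = 1 := by
      intro v w h
      rw [Set.ncard_eq_one]
      refine ⟨w, Set.ext fun x => ?_⟩
      exact (h x x.2).trans Subtype.ext_iff.symm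
    have n1 := Adj.not_adj hab
    have n2 := Adj.not_adj hbc
    have n3 := Adj.not_adj hca
    have la := G.loopless a
    have lb := G.loopless b
    have lc := G.loopless c
    rintro ⟨v, rfl | rfl | rfl⟩
    · refine key _ ⟨b, by simp⟩ ?_
      rintro x (rfl | rfl | rfl) <;> simp [*, h2.symm]
    · refine key _ ⟨c, by simp⟩ ?_
      rintro x (rfl | rfl | rfl) <;> simp [*, h3.symm]
    · refine key _ ⟨a, by simp⟩ ?_
      rintro x (rfl | rfl | rfl) <;> simp [*, h1.symm]

theorem exists_isCyclicTriangle_of_not_isAcyclic (h : ¬ G.IsAcyclic) :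
    ∃ a b c, G.Adj a b ∧ G.Adj b c ∧ G.Adj c a := by
  by_contra! hne
  exact h (isAcyclic_of_forall hne)

theorem not_splitsInto_imp_le_chromaticNumberOn {A : Set V} {k : ℕ}
    (h : ¬ SplitsInto G.TriangleFree A k) : (k : ℕ∞) ≤ G.chromaticNumberOn A := by
  classical
  by_contra! hlt
  obtain ⟨j, hj, f, hf⟩ := exists_of_partitionNumber_lt
    (p := fun B : Set A => ((G.induce A).induce B).IsAcyclic) hlt
  refine h ⟨fun v => if hv : v ∈ A then f ⟨v, hv⟩ else 0, fun v hv => ?_, fun i => ?_⟩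
  · have := (f ⟨v, hv⟩).2
    simp only [hv, dif_pos]
    omega
  · rintro a ⟨ha, ea⟩ b ⟨hb, eb⟩ c ⟨hc, ec⟩ hab hbc hca
    simp only [ha, hb, hc, dif_pos] at ea eb ec
    have hT := triangleFree_of_isAcyclic (hf (f ⟨a, ha⟩))
    refine hT ⟨a, ha⟩ rfl ⟨b, hb⟩ ?_ ⟨c, hc⟩ ?_ hab hbc hca
    · exact Fin.ext (eb.trans ea.symm)
    · exact Fin.ext (ec.trans ea.symm)

end

end Tournament

/-! ### Domination and chromatic number -/

namespace Tournament

section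

variable {V : Type*} (G : Tournament V)

/-- Every vertex of `Y` outside `D` has an in-neighbour in `D`. -/
def Dominates (D : Finset V) (Y : Set V) : Prop := ∀ y ∈ Y, y ∈ D ∨ ∃ d ∈ D, G.Adj d y

end

/-- Harutyunyan, Le, Thomassé and Wu: a set of vertices with large domination number has a subset
of bounded size and large chromatic number. -/
theorem exists_dominates_or_not_splitsInto (k : ℕ) :
    ∃ K s : ℕ, ∀ (V : Type u) [Finite V] (G : Tournament V) (Y : Set V),
      (∃ D : Finset V, (D : Set V) ⊆ Y ∧ D.card ≤ K ∧ G.Dominates D Y) ∨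
      ∃ X : Finset V, (X : Set V) ⊆ Y ∧ X.card ≤ s ∧ ¬ SplitsInto G.TriangleFree (X : Set V) k := by
  classical
  induction k with
  | zero =>
    refine ⟨0, 1, fun V _ G Y => ?_⟩
    rcases Y.eq_empty_or_nonempty with rfl | ⟨y, hy⟩
    · exact Or.inl ⟨∅, by simp, by simp, fun y hy => hy.elim⟩
    · refine Or.inr ⟨{y}, by simpa using hy, by simp, ?_⟩
      rintro ⟨f, hf, -⟩
      exact absurd (hf y (by simp)) (Nat.not_lt_zero _)
  | succ k ih =>
    obtain ⟨K, s, h⟩ := ih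
    -- Trading `r` vertices of a dominating set for at most `s + K` others makes it smaller; `M` is
    -- large enough for `r` of its vertices to share one of `k + 1` colours.
    set r := K + s + 1 with hr
    set M := (k + 1) * r with hM
    refine ⟨K + M, M + s + M.choose r * s, fun V _ G Y => ?_⟩
    by_cases hdom : ∃ D : Finset V, (D : Set V) ⊆ Y ∧ D.card ≤ K + M ∧ G.Dominates D Y
    · exact Or.inl hdom
    refine Or.inr ?_
    obtain ⟨D, ⟨hDY, hD⟩, hmin⟩ := (measure (Finset.card (α := V))).wf.has_min
      {D : Finset V | (D : Set V) ⊆ Y ∧ G.Dominates D Y}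
      ⟨Y.toFinite.toFinset, by simp, fun y hy => Or.inl (by simpa using hy)⟩
    replace hmin : ∀ D' : Finset V, (D' : Set V) ⊆ Y → G.Dominates D' Y → D.card ≤ D'.card :=
      fun D' h1 h2 => not_lt.1 (hmin D' ⟨h1, h2⟩)
    have hDcard : K + M < D.card := by
      by_contra hle
      exact hdom ⟨D, hDY, not_lt.1 hle, hD⟩
    obtain ⟨W, hWD, hWcard⟩ := Finset.exists_subset_card_eq (show M ≤ D.card by omega)
    -- By minimality of `D`, no `K` vertices dominate the part of `Y` that `F` leaves undominated,
    -- so the induction hypothesis gives its second alternative there.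
    have undominated : ∀ F : Finset V, (F : Set V) ⊆ Y → F.card + K < D.card →
        ∃ X : Finset V, (∀ x ∈ X, x ∈ Y ∧ x ∉ F ∧ ∀ d ∈ F, ¬ G.Adj d x) ∧ X.card ≤ s ∧
          ¬ SplitsInto G.TriangleFree (X : Set V) k := by
      intro F hFY hF
      rcases h V G {y | y ∈ Y ∧ y ∉ F ∧ ∀ d ∈ F, ¬ G.Adj d y} with
        ⟨E, hE, hEcard, hEdom⟩ | ⟨X, hX, hXcard, hXs⟩
      · exfalso
        have h1 := hmin (F ∪ E) ?_ ?_
        · have := Finset.card_union_le F E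
          omega
        · rw [Finset.coe_union]
          exact Set.union_subset hFY fun e he => (hE he).1
        · intro y hy
          by_cases hyF : y ∈ F
          · exact Or.inl (Finset.mem_union_left _ hyF)
          by_cases hyd : ∃ d ∈ F, G.Adj d y
          · obtain ⟨d, hd, hdy⟩ := hyd
            exact Or.inr ⟨d, Finset.mem_union_left _ hd, hdy⟩
          push Not at hyd
          rcases hEdom y ⟨hy, hyF, hyd⟩ with h2 | ⟨d, hd, hdy⟩
          · exact Or.inl (Finset.mem_union_right _ h2)
          · exact Or.inr ⟨d, Finset.mem_union_right _ hd, hdy⟩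
      · exact ⟨X, fun x hx => hX hx, hXcard, hXs⟩
    have hWY : (W : Set V) ⊆ Y := fun w hw => hDY (hWD hw)
    obtain ⟨X, hX, hXcard, hXs⟩ := undominated W hWY (by omega)
    -- Each vertex of `Z` has edges to all of `X`, and `D` can dominate it only through `S`.
    have hcrit : ∀ S : Finset V, S ∈ W.powersetCard r → ∃ Z : Finset V,
        (∀ x ∈ Z, x ∈ Y ∧ x ∉ (D \ S) ∪ X ∧ ∀ d ∈ (D \ S) ∪ X, ¬ G.Adj d x) ∧ Z.card ≤ s ∧
          ¬ SplitsInto G.TriangleFree (Z : Set V) k := by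
      intro S hS
      rw [Finset.mem_powersetCard] at hS
      refine undominated _ ?_ ?_
      · rw [Finset.coe_union]
        exact Set.union_subset (fun v hv => hDY (Finset.mem_sdiff.1 hv).1) fun x hx => (hX x hx).1
      · have h1 := Finset.card_union_le (D \ S) X
        have h2 := Finset.card_sdiff_of_subset (hS.1.trans hWD)
        have h3 := Finset.card_le_card (hS.1.trans hWD)
        omega
    choose! Z hZ hZcard hZs using hcrit
    refine ⟨W ∪ X ∪ (W.powersetCard r).biUnion Z, ?_, ?_, ?_⟩
    · intro v hv
      simp only [Finset.coe_union, Finset.coe_biUnion, Set.mem_union, Set.mem_iUnion,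
        Finset.mem_coe] at hv
      rcases hv with (hv | hv) | ⟨S, hS, hv⟩
      · exact hWY hv
      · exact (hX v hv).1
      · exact (hZ S hS v hv).1
    · have h1 := Finset.card_union_le (W ∪ X) ((W.powersetCard r).biUnion Z)
      have h2 := Finset.card_union_le W X
      have h3 := Finset.card_biUnion_le_card_mul (W.powersetCard r) Z s hZcard
      rw [Finset.card_powersetCard, hWcard] at h3
      omega
    · rintro ⟨f, hf, hi⟩
      set U := W ∪ X ∪ (W.powersetCard r).biUnion Z with hU
      have hWU : W ⊆ U := Finset.subset_union_left.trans Finset.subset_union_left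
      have hXU : X ⊆ U := Finset.subset_union_right.trans Finset.subset_union_left
      have hZU : ∀ S ∈ W.powersetCard r, Z S ⊆ U := fun S hS =>
        (Finset.subset_biUnion_of_mem Z hS).trans Finset.subset_union_right
      obtain ⟨i, hik, hcard⟩ := Finset.exists_le_card_fiber_of_mul_le_card_of_maps_to
        (s := W) (t := Finset.range (k + 1)) (f := f) (n := r)
        (fun w hw => Finset.mem_range.2 (hf w (hWU hw))) (by simp) (by simp [hWcard, hM])
      rw [Finset.mem_range] at hik
      obtain ⟨S, hSW, hScard⟩ := Finset.exists_subset_card_eq hcard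
      have hS : S ∈ W.powersetCard r :=
        Finset.mem_powersetCard.2 ⟨hSW.trans (Finset.filter_subset _ _), hScard⟩
      obtain ⟨a, haX, hai⟩ := SplitsInto.exists_color triangleFree_antitone hXs
        (Finset.coe_subset.2 hXU) hf hi hik
      obtain ⟨x, hxZ, hxi⟩ := SplitsInto.exists_color triangleFree_antitone (hZs S hS)
        (Finset.coe_subset.2 (hZU S hS)) hf hi hik
      obtain ⟨hxY, hxF, hxd⟩ := hZ S hS x hxZ
      have hxa : G.Adj x a := by
        refine adj_of_not_adj ?_ (hxd a (Finset.mem_union_right _ haX))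
        rintro rfl
        exact hxF (Finset.mem_union_right _ haX)
      have haw : ∀ w ∈ W, G.Adj a w := by
        intro w hw
        refine adj_of_not_adj ?_ ((hX a haX).2.2 w hw)
        rintro rfl
        exact (hX a haX).2.1 hw
      have hSW' : S ⊆ W := hSW.trans (Finset.filter_subset _ _)
      have hmemS : ∀ d ∈ D, d ∉ (D \ S) ∪ X → d ∈ S := by
        intro d hd hn
        by_contra hdS
        exact hn (Finset.mem_union_left _ (Finset.mem_sdiff.2 ⟨hd, hdS⟩))
      -- Here `x → a → S` in one colour. If `x ∈ S`, then `a → x` is absurd; otherwise some `d ∈ S`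
      -- closes the triangle `x → a → d → x`.
      rcases hD x hxY with hxD | ⟨d, hdD, hdx⟩
      · exact Adj.not_adj hxa (haw x (hSW' (hmemS x hxD hxF)))
      · have hdS : d ∈ S := hmemS d hdD fun hd => hxd d hd hdx
        exact hi i x ⟨hZU S hS hxZ, hxi⟩ a ⟨hXU haX, hai⟩ d
          ⟨hWU (hSW' hdS), (Finset.mem_filter.1 (hSW hdS)).2⟩ hxa (haw d (hSW' hdS)) hdx

end Tournament

/-! ### Thin laws have bounded chromatic number -/

/-- `S` includes no member of `L`. -/
def LawFree {V : Type*} (L : Set (Set V)) (S : Set V) : Prop := ∀ X ∈ L, ¬ X ⊆ S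

theorem lawFree_antitone {V : Type*} {L : Set (Set V)} : Antitone (LawFree L) :=
  fun _ _ h hT X hX hXS => hT X hX (hXS.trans h)

namespace Tournament

/-- The members of `L` have at most `l` vertices, include cyclic triangles, and have sets of common
out-neighbours of chromatic number at most `C`. -/
structure IsThinLaw {V : Type*} (G : Tournament V) (L : Set (Set V)) (C l : ℕ) : Prop where
  ncard_le : ∀ A ∈ L, A.ncard ≤ l
  not_triangleFree : ∀ A ∈ L, ¬ G.TriangleFree A
  splitsInto : ∀ A ∈ L, SplitsInto G.TriangleFree (G.commonOut A) C

namespace IsThinLaw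

variable {V : Type*} {G : Tournament V} {L : Set (Set V)} {C l : ℕ}

/-- This turns bounds on chromatic number into bounds for the law. -/
theorem lawFree_of_triangleFree (hL : G.IsThinLaw L C l) {S : Set V} (h : G.TriangleFree S) :
    LawFree L S :=
  fun A hA hAS => hL.not_triangleFree A hA (triangleFree_antitone hAS h)

theorem nonempty_of_mem (hL : G.IsThinLaw L C l) {A : Set V} (hA : A ∈ L) : A.Nonempty := by
  rw [Set.nonempty_iff_ne_empty]
  rintro rfl
  exact hL.not_triangleFree ∅ hA fun _ ha => ha.elim

theorem lawFree_empty (hL : G.IsThinLaw L C l) : LawFree L ∅ :=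
  hL.lawFree_of_triangleFree fun _ ha => ha.elim

theorem lawFree_singleton (hL : G.IsThinLaw L C l) (v : V) : LawFree L {v} := by
  refine hL.lawFree_of_triangleFree ?_
  rintro a rfl b rfl c rfl h
  exact absurd h (G.loopless _)

theorem splitsInto_biUnion (hL : G.IsThinLaw L C l) {ι : Type*} (X : Finset ι) (Y : ι → Set V)
    {k s : ℕ} (hs : X.card ≤ s) (h : ∀ i ∈ X, SplitsInto (LawFree L) (Y i) k) :
    SplitsInto (LawFree L) (⋃ i ∈ X, Y i) (s * k) :=
  (SplitsInto.biUnion lawFree_antitone hL.lawFree_empty X Y h).mono_right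
    (Nat.mul_le_mul_right k hs)

theorem splitsInto_finset (hL : G.IsThinLaw L C l) (X : Finset V) {s : ℕ} (hs : X.card ≤ s) :
    SplitsInto (LawFree L) (X : Set V) s :=
  (SplitsInto.finset lawFree_antitone hL.lawFree_empty hL.lawFree_singleton X).mono_right hs

theorem splitsInto_union_finset_commonOut (hL : G.IsThinLaw L C l) {A : Finset V}
    (hA : (A : Set V) ∈ L) : SplitsInto (LawFree L) (A ∪ G.commonOut A) (l + C) :=
  (hL.splitsInto_finset A (by simpa using hL.ncard_le _ hA)).union lawFree_antitone
    ((hL.splitsInto _ hA).imp fun _ => hL.lawFree_of_triangleFree)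

variable [Finite V] in
/-- If `Y` is not small, then the vertices with few in-neighbours in `Y` include no member of
`L`. -/
theorem lawFree_few_in (hL : G.IsThinLaw L C l) {Y : Set V} {n : ℕ}
    (hY : ¬ SplitsInto (LawFree L) Y (l + C + l * n)) :
    LawFree L {y | SplitsInto (LawFree L) {v | v ∈ Y ∧ G.Adj v y} n} := by
  intro A hA hAs
  lift A to Finset V using A.toFinite
  -- A vertex of `Y` is in `A`, or a common out-neighbour of `A`, or an in-neighbour of one of the
  -- at most `l` vertices of `A`.
  refine hY (((hL.splitsInto_union_finset_commonOut hA).union lawFree_antitone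
    (hL.splitsInto_biUnion A (fun a => {v | v ∈ Y ∧ G.Adj v a})
      (by simpa using hL.ncard_le _ hA) fun a ha => hAs ha)).mono_left lawFree_antitone ?_)
  intro v hv
  by_cases hvA : v ∈ A
  · exact Or.inl (Or.inl hvA)
  by_cases hout : v ∈ G.commonOut A
  · exact Or.inl (Or.inr hout)
  · simp only [commonOut, Set.mem_ofPred_eq, not_forall] at hout
    obtain ⟨a, ha, hav⟩ := hout
    refine Or.inr (Set.mem_biUnion ha ⟨hv, adj_of_not_adj ?_ hav⟩)
    rintro rfl
    exact hvA ha

end IsThinLaw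

/-- The vertices with few out-neighbours form a small set. -/
theorem exists_splitsInto_few_out (C n : ℕ) : ∃ m : ℕ, ∀ (V : Type u) [Finite V]
    (G : Tournament V) (L : Set (Set V)) (l : ℕ), G.IsThinLaw L C l → ∀ Y : Set V,
      SplitsInto (LawFree L)
        {w | w ∈ Y ∧ SplitsInto (LawFree L) {v | v ∈ Y ∧ G.Adj w v} n} m := by
  obtain ⟨K, s, h⟩ := exists_dominates_or_not_splitsInto.{u} C
  refine ⟨(K + K * n) + (s + s * n + 1), fun V _ G L l hL Y => ?_⟩
  set B := {w | w ∈ Y ∧ SplitsInto (LawFree L) {v | v ∈ Y ∧ G.Adj w v} n} with hB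
  rcases h V G B with ⟨D, hDB, hDcard, hD⟩ | ⟨X, hXB, hXcard, hX⟩
  · refine SplitsInto.mono_right (SplitsInto.mono_left lawFree_antitone
      ((hL.splitsInto_finset D hDcard).union lawFree_antitone
        (hL.splitsInto_biUnion D (fun d => {v | v ∈ Y ∧ G.Adj d v}) hDcard
          fun d hd => (hDB hd).2)) ?_) (Nat.le_add_right _ _)
    intro v hv
    rcases hD v hv with hvD | ⟨d, hd, hdv⟩
    · exact Or.inl hvD
    · exact Or.inr (Set.mem_biUnion hd ⟨hv.1, hdv⟩)
  · have hfree : LawFree L (G.commonIn X) := fun A hA hAX =>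
      hX ((hL.splitsInto A hA).mono_left triangleFree_antitone fun x hx a ha => hAX ha x hx)
    refine SplitsInto.mono_right (SplitsInto.mono_left lawFree_antitone
      (((hL.splitsInto_finset X hXcard).union lawFree_antitone
        (hL.splitsInto_biUnion X (fun x => {v | v ∈ Y ∧ G.Adj x v}) hXcard
          fun x hx => (hXB hx).2)).union lawFree_antitone
        (SplitsInto.one lawFree_antitone hfree)) ?_) (Nat.le_add_left _ _)
    intro v hv
    by_cases hvX : v ∈ X
    · exact Or.inl (Or.inl hvX)
    by_cases hin : v ∈ G.commonIn X
    · exact Or.inr hin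
    · simp only [commonIn, Set.mem_ofPred_eq, not_forall] at hin
      obtain ⟨x, hx, hvx⟩ := hin
      refine Or.inl (Or.inr (Set.mem_biUnion hx ⟨hv.1, adj_of_not_adj ?_ hvx⟩))
      rintro rfl
      exact hvX hx

/-- Every set that is not small has a subset of bounded size in which all vertices outside a small
set have out-neighbourhoods of large chromatic number. -/
theorem exists_finset_out_chromatic (C l c : ℕ) : ∃ N b s : ℕ, ∀ (V : Type u) [Finite V]
    (G : Tournament V) (L : Set (Set V)), G.IsThinLaw L C l → ∀ Y : Set V,
      ¬ SplitsInto (LawFree L) Y N → ∃ X : Finset V, (X : Set V) ⊆ Y ∧ X.card ≤ s ∧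
        SplitsInto (LawFree L)
          {p | SplitsInto G.TriangleFree {x | x ∈ X ∧ G.Adj p x} c} b := by
  classical
  induction c with
  | zero =>
    refine ⟨1, l + C, l, fun V _ G L hL Y hY => ?_⟩
    have hex : ∃ A ∈ L, A ⊆ Y := by
      by_contra! hne
      exact hY (SplitsInto.one lawFree_antitone hne)
    obtain ⟨A, hA, hAY⟩ := hex
    lift A to Finset V using A.toFinite
    refine ⟨A, hAY, by simpa using hL.ncard_le _ hA,
      (hL.splitsInto_union_finset_commonOut hA).mono_left lawFree_antitone ?_⟩
    rintro p ⟨f, hf, -⟩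
    by_cases hpA : p ∈ A
    · exact Or.inl hpA
    · refine Or.inr fun a ha => adj_of_not_adj ?_ fun hpa =>
        absurd (hf a ⟨ha, hpa⟩) (Nat.not_lt_zero _)
      rintro rfl
      exact hpA ha
  | succ c ih =>
    obtain ⟨N, b, s, h⟩ := ih
    -- The threshold is what `lawFree_few_in` needs for out-neighbourhoods, with `n = N`.
    obtain ⟨m, hm⟩ := exists_splitsInto_few_out.{u} C (l + C + l * N)
    refine ⟨(m + 1 + N) + (l + C + l * (N + 1)), b + s * (b + s * b), s + s * (s + s * s),
      fun V _ G L hL Y hY => ?_⟩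
    have hYin : ¬ SplitsInto (LawFree L) Y (l + C + l * (N + 1)) := fun h' =>
      hY (h'.mono_right (Nat.le_add_left _ _))
    -- For `y ∈ T w` and `z ∈ Z w y`, the edges `z → y → w → z` form a cyclic triangle.
    set Z : V → V → Set V := fun w y => {v | (v ∈ Y ∧ G.Adj w v) ∧ G.Adj v y} with hZ
    set T : V → Set V := fun w =>
      {y | (y ∈ Y ∧ G.Adj y w) ∧ ¬ SplitsInto (LawFree L) (Z w y) N} with hT
    -- Discard the vertices with small out-neighbourhood (`m` parts) or small in-neighbourhood (one
    -- part). For any other `w`, one more part removes the in-neighbours `y` with `Z w y` small, so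
    -- `T w` is still not small.
    have hgood : ¬ SplitsInto (LawFree L)
        {w | w ∈ Y ∧ ¬ SplitsInto (LawFree L) (T w) N} N := by
      intro hN
      refine hY (SplitsInto.mono_right (SplitsInto.mono_left lawFree_antitone
        (((hm V G L l hL Y).union lawFree_antitone
          (SplitsInto.one lawFree_antitone (hL.lawFree_few_in hYin))).union lawFree_antitone hN)
            ?_) (Nat.le_add_right _ _))
      intro w hw
      by_cases h1 : SplitsInto (LawFree L) {v | v ∈ Y ∧ G.Adj w v} (l + C + l * N)
      · exact Or.inl (Or.inl ⟨hw, h1⟩)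
      by_cases h2 : SplitsInto (LawFree L) {v | v ∈ Y ∧ G.Adj v w} (N + 1)
      · exact Or.inl (Or.inr h2)
      refine Or.inr ⟨hw, fun h3 => h2 ?_⟩
      refine SplitsInto.mono_left lawFree_antitone (h3.union lawFree_antitone
        (SplitsInto.one lawFree_antitone (hL.lawFree_few_in h1))) ?_
      intro y hy
      by_cases h4 : SplitsInto (LawFree L) (Z w y) N
      · exact Or.inr h4
      · exact Or.inl ⟨hy, h4⟩
    obtain ⟨X₀, hX₀, hX₀card, hX₀b⟩ := h V G L hL _ hgood
    have h1 : ∀ w ∈ X₀, ∃ X : Finset V, (X : Set V) ⊆ T w ∧ X.card ≤ s ∧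
        SplitsInto (LawFree L)
          {p | SplitsInto G.TriangleFree {x | x ∈ X ∧ G.Adj p x} c} b :=
      fun w hw => h V G L hL _ (hX₀ hw).2
    choose! X₁ hX₁ hX₁card hX₁b using h1
    have h2 : ∀ w ∈ X₀, ∀ y ∈ X₁ w, ∃ X : Finset V, (X : Set V) ⊆ Z w y ∧ X.card ≤ s ∧
        SplitsInto (LawFree L)
          {p | SplitsInto G.TriangleFree {x | x ∈ X ∧ G.Adj p x} c} b :=
      fun w hw y hy => h V G L hL _ (hX₁ w hw hy).2
    choose! X₂ hX₂ hX₂card hX₂b using h2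
    set U := X₀ ∪ X₀.biUnion fun w => X₁ w ∪ (X₁ w).biUnion (X₂ w) with hU
    have hU₀ : ∀ w ∈ X₀, w ∈ U := fun w hw => Finset.mem_union_left _ hw
    have hU₁ : ∀ w ∈ X₀, ∀ y ∈ X₁ w, y ∈ U := fun w hw y hy =>
      Finset.mem_union_right _ (Finset.mem_biUnion.2 ⟨w, hw, Finset.mem_union_left _ hy⟩)
    have hU₂ : ∀ w ∈ X₀, ∀ y ∈ X₁ w, ∀ z ∈ X₂ w y, z ∈ U := fun w hw y hy z hz =>
      Finset.mem_union_right _ (Finset.mem_biUnion.2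
        ⟨w, hw, Finset.mem_union_right _ (Finset.mem_biUnion.2 ⟨y, hy, hz⟩)⟩)
    refine ⟨U, ?_, ?_, ?_⟩
    · intro v hv
      rw [Finset.mem_coe, hU, Finset.mem_union, Finset.mem_biUnion] at hv
      rcases hv with hv | ⟨w, hw, hv⟩
      · exact (hX₀ hv).1
      rw [Finset.mem_union, Finset.mem_biUnion] at hv
      rcases hv with hv | ⟨y, hy, hv⟩
      · exact (hX₁ w hw hv).1.1
      · exact (hX₂ w hw y hy hv).1.1
    · refine (Finset.card_union_le _ _).trans (Nat.add_le_add hX₀card ?_)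
      refine (Finset.card_biUnion_le_card_mul _ _ (s + s * s) fun w hw => ?_).trans
        (Nat.mul_le_mul_right _ hX₀card)
      refine (Finset.card_union_le _ _).trans (Nat.add_le_add (hX₁card w hw) ?_)
      exact (Finset.card_biUnion_le_card_mul _ _ s fun y hy => hX₂card w hw y hy).trans
        (Nat.mul_le_mul_right _ (hX₁card w hw))
    · refine (hX₀b.union lawFree_antitone (hL.splitsInto_biUnion X₀ _ hX₀card fun w hw =>
        (hX₁b w hw).union lawFree_antitone (hL.splitsInto_biUnion (X₁ w) _ (hX₁card w hw)
          fun y hy => hX₂b w hw y hy))).mono_left lawFree_antitone ?_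
      rintro p ⟨f, hf, hi⟩
      by_contra hp
      simp only [Set.mem_union, Set.mem_iUnion, Set.mem_ofPred_eq, not_or, not_exists] at hp
      obtain ⟨hp₀, hp₁⟩ := hp
      -- In each layer the out-neighbours of `p` need more than `c` colours, so colour `0` occurs
      -- among them; the three choices form a cyclic triangle.
      obtain ⟨w, ⟨hw, hpw⟩, hw0⟩ := SplitsInto.exists_color triangleFree_antitone hp₀
        (Z := {x | x ∈ U ∧ G.Adj p x}) (fun v hv => ⟨hU₀ v hv.1, hv.2⟩) hf hi (Nat.succ_pos c)
      obtain ⟨hp₁, hp₂⟩ := hp₁ w hw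
      obtain ⟨y, ⟨hy, hpy⟩, hy0⟩ := SplitsInto.exists_color triangleFree_antitone hp₁
        (Z := {x | x ∈ U ∧ G.Adj p x}) (fun v hv => ⟨hU₁ w hw v hv.1, hv.2⟩) hf hi (Nat.succ_pos c)
      obtain ⟨z, ⟨hz, hpz⟩, hz0⟩ := SplitsInto.exists_color triangleFree_antitone (hp₂ y hy)
        (Z := {x | x ∈ U ∧ G.Adj p x}) (fun v hv => ⟨hU₂ w hw y hy v hv.1, hv.2⟩) hf hi (Nat.succ_pos c)
      exact hi 0 z ⟨⟨hU₂ w hw y hy z hz, hpz⟩, hz0⟩ y ⟨⟨hU₁ w hw y hy, hpy⟩, hy0⟩ w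
        ⟨⟨hU₀ w hw, hpw⟩, hw0⟩ (hX₂ w hw y hy hz).2 (hX₁ w hw hy).1.2 (hX₂ w hw y hy hz).1.2

/-- If all members of a law of bounded order have sets of common out-neighbours of bounded
chromatic number, then the chromatic number for the law is bounded. -/
theorem exists_splitsInto_of_isThinLaw (C l : ℕ) : ∃ n : ℕ, ∀ (V : Type u) [Finite V]
    (G : Tournament V) (L : Set (Set V)), G.IsThinLaw L C l →
      SplitsInto (LawFree L) Set.univ n := by
  classical
  obtain ⟨N, b, s, h⟩ := exists_finset_out_chromatic.{u} C l C
  refine ⟨N + (b + 2 ^ s * 1), fun V _ G L hL => ?_⟩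
  by_cases hN : SplitsInto (LawFree L) Set.univ N
  · exact hN.mono_right (Nat.le_add_right _ _)
  obtain ⟨X, -, hXcard, hXb⟩ := h V G L hL _ hN
  set P := {p | SplitsInto G.TriangleFree {x | x ∈ X ∧ G.Adj p x} C} with hP
  -- All vertices of a member in this class would be adjacent to all of `S`, which needs more than
  -- `C` parts.
  have hclass : ∀ S : Finset V, LawFree L {p | p ∉ P ∧ X.filter (G.Adj p) = S} := by
    intro S A hA hAS
    obtain ⟨a, ha⟩ := hL.nonempty_of_mem hA
    refine (hAS ha).1 ((hL.splitsInto A hA).mono_left triangleFree_antitone fun x hx a' ha' => ?_)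
    have hxS : x ∈ S := by
      rw [← (hAS ha).2]
      exact Finset.mem_filter.2 hx
    rw [← (hAS ha').2] at hxS
    exact (Finset.mem_filter.1 hxS).2
  refine SplitsInto.mono_right (SplitsInto.mono_left lawFree_antitone
    (hXb.union lawFree_antitone (hL.splitsInto_biUnion X.powerset
      (fun S => {p | p ∉ P ∧ X.filter (G.Adj p) = S}) (s := 2 ^ s) ?_
      fun S _ => SplitsInto.one lawFree_antitone (hclass S))) ?_) (Nat.le_add_left _ _)
  · rw [Finset.card_powerset]
    exact Nat.pow_le_pow_right two_pos hXcard
  · intro p _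
    by_cases hp : p ∈ P
    · exact Or.inl hp
    · exact Or.inr (Set.mem_biUnion (Finset.mem_powerset.2 (Finset.filter_subset (G.Adj p) X))
        ⟨hp, rfl⟩)

end Tournament

/-! ### Two-sided theorem for laws, and its applications -/

namespace Tournament

section

variable {V : Type*} {G : Tournament V}

theorem TriangleFree.of_reverse {S : Set V} (h : G.reverse.TriangleFree S) : G.TriangleFree S :=
  fun a ha b hb c hc hab hbc hca => h c hc b hb a ha hbc hab hca

theorem TriangleFree.reverse {S : Set V} (h : G.TriangleFree S) : G.reverse.TriangleFree S :=
  fun a ha b hb c hc hab hbc hca => h c hc b hb a ha hbc hab hca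

theorem completePair_commonIn (A : Set V) : G.CompletePair (G.commonIn A) A :=
  ⟨Set.disjoint_left.2 fun v hv hvA => G.loopless v (hv v hvA),
    fun _ hv a ha => Adj.not_adj (hv a ha)⟩

theorem completePair_commonOut (A : Set V) : G.CompletePair A (G.commonOut A) :=
  ⟨Set.disjoint_left.2 fun v hvA hv => G.loopless v (hv v hvA),
    fun a ha _ hv => Adj.not_adj (hv a ha)⟩

theorem disjoint_commonIn_commonOut {A : Set V} (hA : A.Nonempty) :
    Disjoint (G.commonIn A) (G.commonOut A) :=
  Set.disjoint_left.2 fun _ hv hv' => Adj.not_adj (hv _ hA.some_mem) (hv' _ hA.some_mem)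

theorem not_triangleFree_of_isLaw {L : Set (Set V)} (hL : G.IsLaw L) {A : Set V} (hA : A ∈ L) :
    ¬ G.TriangleFree A := by
  obtain ⟨T, hTA, hT⟩ := hL A hA
  exact fun h => not_triangleFree_of_isCyclicTriangle hT (triangleFree_antitone hTA h)

end

theorem exists_law_member_between (c l : ℕ) : ∃ n : ℕ, ∀ (V : Type u) [Finite V]
    (G : Tournament V) (L : Set (Set V)), G.IsLaw L → (∀ A ∈ L, A.ncard ≤ l) →
      (n : ℕ∞) < lawChromaticNumber L →
      ∃ P A Q : Set V, Disjoint P Q ∧ G.CompletePair P A ∧ G.CompletePair A Q ∧ A ∈ L ∧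
        (c : ℕ∞) ≤ G.chromaticNumberOn P ∧ (c : ℕ∞) ≤ G.chromaticNumberOn Q := by
  obtain ⟨n, hn⟩ := exists_splitsInto_of_isThinLaw.{u} c l
  refine ⟨n * n, fun V _ G L hL hcard hlarge => ?_⟩
  by_contra hne
  have hthin : ∀ A ∈ L, SplitsInto G.TriangleFree (G.commonIn A) c ∨
      SplitsInto G.TriangleFree (G.commonOut A) c := by
    intro A hA
    by_contra! h
    have hAne : A.Nonempty := by
      rw [Set.nonempty_iff_ne_empty]
      rintro rfl
      exact not_triangleFree_of_isLaw hL hA fun _ ha => ha.elim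
    exact hne ⟨G.commonIn A, A, G.commonOut A, disjoint_commonIn_commonOut hAne,
      completePair_commonIn A, completePair_commonOut A, hA,
      not_splitsInto_imp_le_chromaticNumberOn h.1, not_splitsInto_imp_le_chromaticNumberOn h.2⟩
  have hout := hn V G {A | A ∈ L ∧ SplitsInto G.TriangleFree (G.commonOut A) c}
    ⟨fun A hA => hcard A hA.1, fun A hA => not_triangleFree_of_isLaw hL hA.1, fun A hA => hA.2⟩
  -- Reversal exchanges common in- and out-neighbours and keeps triangle-freeness.
  have hin := hn V G.reverse {A | A ∈ L ∧ SplitsInto G.TriangleFree (G.commonIn A) c}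
    ⟨fun A hA => hcard A hA.1, fun A hA h => not_triangleFree_of_isLaw hL hA.1 h.of_reverse,
      fun A hA => SplitsInto.imp hA.2 fun _ h => h.reverse⟩
  refine absurd (partitionNumber_le (SplitsInto.imp
    (hout.inter lawFree_antitone lawFree_antitone hin) ?_)) (not_le.2 hlarge)
  rintro S ⟨h1, h2⟩ A hA hAS
  rcases hthin A hA with h | h
  · exact h2 A ⟨hA, h⟩ hAS
  · exact h1 A ⟨hA, h⟩ hAS

theorem ncard_le_lawOrder {V : Type*} [Finite V] {L : Set (Set V)} {A : Set V} (hA : A ∈ L) :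
    A.ncard ≤ lawOrder L := by
  rw [lawOrder, if_neg (Set.nonempty_iff_ne_empty.1 ⟨A, hA⟩)]
  exact le_csSup (Set.toFinite _).bddAbove (Set.mem_image_of_mem _ hA)

/-- The vertex sets of the subtournaments of `G` that are isomorphic to `H`. -/
def copies {V W : Type*} (G : Tournament V) (H : Tournament W) : Set (Set V) :=
  {A | (G.induce A).IsIsomorphic H}

section

variable {V W : Type*} {G : Tournament V} {H : Tournament W}

/-- Chromatic number at least two rules out acyclicity, so `H` has a cyclic triangle, and the
isomorphism carries it into each copy. -/
theorem isLaw_copies (hH : 2 ≤ H.chromaticNumber) : G.IsLaw (G.copies H) := by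
  rintro A ⟨φ⟩
  have hcyc : ¬ (H.induce Set.univ).IsAcyclic := fun h =>
    absurd (hH.trans (partitionNumber_le_one h)) (by decide)
  obtain ⟨a, b, c, hab, hbc, hca⟩ := exists_isCyclicTriangle_of_not_isAcyclic hcyc
  refine ⟨{(φ.symm a.1).1, (φ.symm b.1).1, (φ.symm c.1).1}, ?_, isCyclicTriangle_of_adj
    (φ.symm.map_rel_iff.2 hab) (φ.symm.map_rel_iff.2 hbc) (φ.symm.map_rel_iff.2 hca)⟩
  rintro x (rfl | rfl | rfl) <;> exact Subtype.coe_prop _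

theorem ncard_of_mem_copies {A : Set V} (hA : A ∈ G.copies H) : A.ncard = Nat.card W := by
  obtain ⟨φ⟩ := hA
  rw [← Nat.card_coe_set_eq]
  exact Nat.card_congr φ.toEquiv

theorem isFree_of_lawFree_copies {S : Set V} (h : LawFree (G.copies H) S) :
    (G.induce S).IsFree H := by
  rintro B ⟨φ⟩
  refine h (Subtype.val '' B) ⟨RelIso.trans (RelIso.symm ?_) φ⟩ ?_
  · exact ⟨Equiv.Set.image Subtype.val B Subtype.val_injective, fun {_ _} => Iff.rfl⟩
  · rintro _ ⟨x, -, rfl⟩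
    exact x.2

/-- The vertex sets of the cyclic triangles of `G`. -/
def cyclicTriangles (G : Tournament V) : Set (Set V) := {A | (G.induce A).IsCyclicTriangle}

theorem isAcyclic_of_lawFree_cyclicTriangles {S : Set V} (h : LawFree G.cyclicTriangles S) :
    (G.induce S).IsAcyclic := by
  by_contra hS
  obtain ⟨a, b, c, hab, hbc, hca⟩ := exists_isCyclicTriangle_of_not_isAcyclic hS
  refine h {a.1, b.1, c.1} (isCyclicTriangle_of_adj hab hbc hca) ?_
  rintro x (rfl | rfl | rfl) <;> exact Subtype.coe_prop _

end

theorem exists_copy_between {W : Type v} (H : Tournament W) (hH : 2 ≤ H.chromaticNumber)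
    (c : ℕ) : ∃ d : ℕ, ∀ (V : Type u) [Finite V] (G : Tournament V),
      (d : ℕ∞) ≤ freeChromaticNumber H G →
      ∃ P A Q : Set V, Disjoint P Q ∧ G.CompletePair P A ∧ G.CompletePair A Q ∧
        (G.induce A).IsIsomorphic H ∧
        (c : ℕ∞) ≤ G.chromaticNumberOn P ∧ (c : ℕ∞) ≤ G.chromaticNumberOn Q := by
  obtain ⟨n, hn⟩ := exists_law_member_between.{u} c (Nat.card W)
  -- Law-free parts for the copies are `H`-free, so `χ_H` is at most the law's chromatic number; the
  -- `+ 1` gives the strict inequality.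
  refine ⟨n + 1, fun V _ G hd => hn V G (G.copies H) (isLaw_copies hH)
    (fun A hA => (ncard_of_mem_copies hA).le) (lt_of_lt_of_le ?_ (hd.trans
      (partitionNumber_mono fun _ => isFree_of_lawFree_copies)))⟩
  exact_mod_cast Nat.lt_succ_self n

theorem exists_cyclicTriangle_between (c : ℕ) : ∃ d : ℕ, ∀ (V : Type u) [Finite V]
    (G : Tournament V), (d : ℕ∞) ≤ G.chromaticNumber →
      ∃ P A Q : Set V, Disjoint P Q ∧ G.CompletePair P A ∧ G.CompletePair A Q ∧
        (G.induce A).IsCyclicTriangle ∧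
        (c : ℕ∞) ≤ G.chromaticNumberOn P ∧ (c : ℕ∞) ≤ G.chromaticNumberOn Q := by
  obtain ⟨n, hn⟩ := exists_law_member_between.{u} c 3
  refine ⟨n + 1, fun V _ G hd => hn V G G.cyclicTriangles (fun A hA => ⟨A, subset_rfl, hA⟩)
    (fun A hA => ?_) (lt_of_lt_of_le ?_ (hd.trans
      (partitionNumber_mono fun _ => isAcyclic_of_lawFree_cyclicTriangles)))⟩
  · rw [← Nat.card_coe_set_eq]
    exact hA.1.le
  · exact_mod_cast Nat.lt_succ_self n

end Tournament

theorem theorem3p6 :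
    -- copies of a tournament `H` with chromatic number at least two
    (∀ (W : Type v) [Finite W] (H : Tournament W), 2 ≤ H.chromaticNumber →
      ∀ c : ℕ, ∃ d : ℕ, ∀ (V : Type u) [Finite V] (G : Tournament V),
        (d : ℕ∞) ≤ Tournament.freeChromaticNumber H G →
        ∃ P A Q : Set V, Disjoint P Q ∧ G.CompletePair P A ∧ G.CompletePair A Q ∧
          (G.induce A).IsIsomorphic H ∧
          (c : ℕ∞) ≤ G.chromaticNumberOn P ∧ (c : ℕ∞) ≤ G.chromaticNumberOn Q) ∧
    -- laws of bounded order
    (∀ c l : ℕ, ∃ n : ℕ, ∀ (V : Type u) [Finite V] (G : Tournament V) (L : Set (Set V)),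
        G.IsLaw L → lawOrder L ≤ l → (n : ℕ∞) < lawChromaticNumber L →
        ∃ P A Q : Set V, Disjoint P Q ∧ G.CompletePair P A ∧ G.CompletePair A Q ∧
          A ∈ L ∧
          (c : ℕ∞) ≤ G.chromaticNumberOn P ∧ (c : ℕ∞) ≤ G.chromaticNumberOn Q) ∧
    -- cyclic triangles
    (∀ c : ℕ, ∃ d : ℕ, ∀ (V : Type u) [Finite V] (G : Tournament V),
        (d : ℕ∞) ≤ G.chromaticNumber →
        ∃ P A Q : Set V, Disjoint P Q ∧ G.CompletePair P A ∧ G.CompletePair A Q ∧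
          (G.induce A).IsCyclicTriangle ∧
          (c : ℕ∞) ≤ G.chromaticNumberOn P ∧ (c : ℕ∞) ≤ G.chromaticNumberOn Q) ∧
    -- a cyclic triangle complete to a set of large chromatic number
    (∀ c : ℕ, ∃ d : ℕ, ∀ (V : Type u) [Finite V] (G : Tournament V),
        (d : ℕ∞) ≤ G.chromaticNumber →
        ∃ A B : Set V, G.CompletePair A B ∧
          (G.induce A).IsCyclicTriangle ∧ (c : ℕ∞) ≤ G.chromaticNumberOn B) := by
  refine ⟨fun W _ H hH c => Tournament.exists_copy_between H hH c, fun c l => ?_,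
    Tournament.exists_cyclicTriangle_between, fun c => ?_⟩
  · obtain ⟨n, hn⟩ := Tournament.exists_law_member_between.{u} c l
    exact ⟨n, fun V _ G L hL hl =>
      hn V G L hL fun A hA => (Tournament.ncard_le_lawOrder hA).trans hl⟩
  · obtain ⟨d, hd⟩ := Tournament.exists_cyclicTriangle_between.{u} c
    refine ⟨d, fun V _ G hG => ?_⟩
    obtain ⟨-, A, Q, -, -, hAQ, hA, -, hQ⟩ := hd V G hG
    exact ⟨A, Q, hAQ, hA, hQ⟩
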